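/- Let $\mathbb{H}(\mathbb{C})$ be the algebra of quaternions over $\mathbb{C}$ with basis $1,I,J,K$ ($I^2=J^2=K^2=-1$, $IJ=-JI=K$, $JK=-KJ=I$, $KI=-IK=J$), and let $$e_1=\tfrac12(1+iI),\quad e_2=\tfrac12(1-iI),\quad e_3=\tfrac12(iJ-K),\quad e_4=\tfrac12(iJ+K),$$ with the norm $\|\sum_k c_ke_k\|=\bigl(\sum_k|c_k|^2\bigr)^{1/2}$ for $c_k\in\mathbb{C}$. Let $f_1,f_2:\mathbb{H}(\mathbb{C})\to\mathbb{C}$ be the linear functionals with $f_1(e_1)=f_1(e_3)=1$, $f_1(e_2)=f_1(e_4)=0$, $f_2(e_2)=f_2(e_4)=1$, $f_2(e_1)=f_2(e_3)=0$. Let $a_1,a_2,b_1,b_2\in\mathbb{C}$ be such that $i_1=1$, $i_2=a_1e_1+a_2e_2$, $i_3=b_1e_1+b_2e_2$ are linearly independent over $\mathbb{R}$, let $E_3=\{xi_1+yi_2+zi_3: x,y,z\in\mathbb{R}\}$, and assume $f_1(E_3)=f_2(E_3)=\mathbb{C}$. For $k=1,2$ let $L_k\subset\mathbb{R}^3$ be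 the line $x+y\operatorname{Re}a_k+z\operatorname{Re}b_k=0$, $y\operatorname{Im}a_k+z\operatorname{Im}b_k=0$. Let $\Omega\subset\mathbb{R}^3$ be a domain (a non-empty connected open set) that is convex in the direction of $L_1$ and of $L_2$, that is, $\Omega$ contains every segment parallel to $L_1$ or to $L_2$ that joins two points of $\Omega$. Put $\Omega_\zeta=\{xi_1+yi_2+zi_3:(x,y,z)\in\Omega\}$, $D_1=f_1(\Omega_\zeta)$, $D_2=f_2(\Omega_\zeta)$. A map $\widehat\Phi:\Omega_\zeta\to\mathbb{H}(\mathbb{C})$ is called left-$G$-monogenic if it is continuous and for every $\zeta\in\Omega_\zeta$ there is $\widehat\Phi'(\zeta)\in\mathbb{H}(\mathbb{C})$ with $$\lim_{\varepsilon\to0+}\bigl(\widehat\Phi(\zeta+\varepsilon h)-\widehat\Phi(\zeta)\bigr)\varepsilon^{-1}=\widehat\Phi'(\zeta)h\qquad\text{for all }h\in E_3.$$ Theorem. For every left-$G$-monogenic map $\widehat\Phi:\Omega_\zeta\to\mathbb{H}(\mathbb{C})$ there are functions $F_1,F_4$ analytic on $D_1$ and $F_2,F_3$ analytic on $D_2$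 such that $$\widehat\Phi(\zeta)=F_1(\xi_1)e_1+F_2(\xi_2)e_2+F_3(\xi_2)e_3+F_4(\xi_1)e_4$$ for all $\zeta=xi_1+yi_2+zi_3\in\Omega_\zeta$, where $\xi_1=f_1(\zeta)=x+ya_1+zb_1$ and $\xi_2=f_2(\zeta)=x+ya_2+zb_2$. -/

import Mathlib

open scoped Quaternion Topology

noncomputable section

namespace CQuat

/-- `e₁ = (1 + iI)/2` in the algebra `ℍ[ℂ]` of complex quaternions, where `⟨w, x, y, z⟩ = w + xI + yJ + zK`. -/
def e₁ : ℍ[ℂ] := ⟨1 / 2, Complex.I / 2, 0, 0⟩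

/-- `e₂ = (1 - iI)/2` -/
def e₂ : ℍ[ℂ] := ⟨1 / 2, -Complex.I / 2, 0, 0⟩

/-- `e₃ = (iJ - K)/2` -/
def e₃ : ℍ[ℂ] := ⟨0, 0, Complex.I / 2, -1 / 2⟩

/-- `e₄ = (iJ + K)/2` -/
def e₄ : ℍ[ℂ] := ⟨0, 0, Complex.I / 2, 1 / 2⟩

/-- The coordinates of a complex quaternion in the basis `e₁, e₂, e₃, e₄`
(see `eq_sum_coords` and `coords_sum`). -/
def coords : ℍ[ℂ] →ₗ[ℂ] EuclideanSpace ℂ (Fin 4) where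
  toFun q := !₂[q.re - Complex.I * q.imI, q.re + Complex.I * q.imI,
    -Complex.I * q.imJ - q.imK, -Complex.I * q.imJ + q.imK]
  map_add' p q := by
    ext k; fin_cases k <;> simp <;> ring
  map_smul' c q := by
    ext k; fin_cases k <;> simp <;> ring

theorem eq_sum_coords (q : ℍ[ℂ]) :
    q = coords q 0 • e₁ + coords q 1 • e₂ + coords q 2 • e₃ + coords q 3 • e₄ := by
  have hI := Complex.I_mul_I
  ext <;> simp [coords] <;> simp [e₁, e₂, e₃, e₄] <;> grind

theorem coords_sum (c₁ c₂ c₃ c₄ : ℂ) :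
    coords (c₁ • e₁ + c₂ • e₂ + c₃ • e₃ + c₄ • e₄) = !₂[c₁, c₂, c₃, c₄] := by
  have hI := Complex.I_mul_I
  ext k; fin_cases k <;> simp [coords] <;> simp [e₁, e₂, e₃, e₄] <;> grind

theorem coords_injective : Function.Injective coords := fun p q h => by
  rw [eq_sum_coords p, eq_sum_coords q, h]

/-- The norm `‖q‖ = (∑ |qₖ|²)^(1/2)`, where `q = ∑ qₖ eₖ` (see `norm_eq`). -/
instance instNormedAddCommGroup : NormedAddCommGroup ℍ[ℂ] :=
  NormedAddCommGroup.induced ℍ[ℂ] (EuclideanSpace ℂ (Fin 4)) coords coords_injective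

theorem norm_eq (q : ℍ[ℂ]) : ‖q‖ = √(∑ k, ‖coords q k‖ ^ 2) :=
  EuclideanSpace.norm_eq (coords q)

/-- The linear functional with `f₁(e₁) = f₁(e₃) = 1` and `f₁(e₂) = f₁(e₄) = 0`. -/
def f₁ : ℍ[ℂ] →ₗ[ℂ] ℂ where
  toFun q := coords q 0 + coords q 2
  map_add' p q := by simp; ring
  map_smul' c q := by simp; ring

/-- The linear functional with `f₂(e₂) = f₂(e₄) = 1` and `f₂(e₁) = f₂(e₃) = 0`. -/
def f₂ : ℍ[ℂ] →ₗ[ℂ] ℂ where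
  toFun q := coords q 1 + coords q 3
  map_add' p q := by simp; ring
  map_smul' c q := by simp; ring

/-- The real linear span of three vectors `i₁, i₂, i₃`. -/
def E₃ (i₁ i₂ i₃ : ℍ[ℂ]) : Submodule ℝ ℍ[ℂ] := Submodule.span ℝ {i₁, i₂, i₃}

/-- The point `ζ = x i₁ + y i₂ + z i₃` for `p = (x, y, z)`. -/
def zeta (i₁ i₂ i₃ : ℍ[ℂ]) (p : EuclideanSpace ℝ (Fin 3)) : ℍ[ℂ] :=
  p 0 • i₁ + p 1 • i₂ + p 2 • i₃

theorem f₁_zeta (a₁ a₂ b₁ b₂ : ℂ) (p : EuclideanSpace ℝ (Fin 3)) :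
    f₁ (zeta 1 (a₁ • e₁ + a₂ • e₂) (b₁ • e₁ + b₂ • e₂) p) = p 0 + p 1 * a₁ + p 2 * b₁ := by
  have hI := Complex.I_mul_I
  simp [f₁, zeta, coords]
  simp [e₁, e₂]
  grind

theorem f₂_zeta (a₁ a₂ b₁ b₂ : ℂ) (p : EuclideanSpace ℝ (Fin 3)) :
    f₂ (zeta 1 (a₁ • e₁ + a₂ • e₂) (b₁ • e₁ + b₂ • e₂) p) = p 0 + p 1 * a₂ + p 2 * b₂ := by
  have hI := Complex.I_mul_I
  simp [f₂, zeta, coords]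
  simp [e₁, e₂]
  grind

/-- The line `x + y Re a + z Re b = 0`, `y Im a + z Im b = 0` through the origin of `ℝ³`. -/
def line (a b : ℂ) : Set (EuclideanSpace ℝ (Fin 3)) :=
  {p | p 0 + p 1 * a.re + p 2 * b.re = 0 ∧ p 1 * a.im + p 2 * b.im = 0}

/-- `Ω` is convex in the direction of a line `L` through the origin: it contains every segment
that is parallel to `L` and joins two points of `Ω`. -/
def ConvexInDirection (Ω L : Set (EuclideanSpace ℝ (Fin 3))) : Prop :=
  ∀ p ∈ Ω, ∀ q ∈ Ω, q - p ∈ L → segment ℝ p q ⊆ Ω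

/-- A map `Φ` is left-`G`-monogenic in a domain `S` of the real subspace `E`: it is continuous
on `S`, and at every `ζ ∈ S` it has a left Gateaux derivative `Φ'`, that is, for all `h ∈ E`,
`(Φ(ζ + ε h) - Φ(ζ)) ε⁻¹ → Φ' h` as `ε → 0+`. As `S` is open in `E`, only the values of `Φ` on `S`
matter. -/
def LeftGMonogenic (E : Submodule ℝ ℍ[ℂ]) (S : Set ℍ[ℂ]) (Φ : ℍ[ℂ] → ℍ[ℂ]) : Prop :=
  ContinuousOn Φ S ∧
    ∀ ζ ∈ S, ∃ Φ' : ℍ[ℂ], ∀ h ∈ E,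
      Filter.Tendsto (fun ε : ℝ => ε⁻¹ • (Φ (ζ + ε • h) - Φ ζ)) (𝓝[>] 0) (𝓝 (Φ' * h))

end CQuat

end

/-! Since `ζ = ξ₁e₁ + ξ₂e₂` multiplies coordinates from the right diagonally (`coords_mul`), each
coordinate of `Φ` has one-sided directional derivatives `c * l v`, with `l` one of the two linear
forms. They vanish on the kernel of `l`, so by directional convexity the coordinate is a function
`F` of `l` alone (`exists_analyticOnNhd_comp_of_tendsto`).

What remains is that a continuous `F` with complex linear one-sided Gateaux derivatives is analytic.
Baire's theorem on the set `S` of non-analytic points gives linear bounds along axis-parallel rays,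
uniform over a relatively open piece of `S`. The maximum principle spreads them from the rays to all
directions, Cauchy's estimate then makes `F` Lipschitz near a point of `S`, and Lipschitz plus
linear directional derivatives gives complex differentiability there: a contradiction. -/

/-! ### Analyticity from one-sided directional derivatives -/

open Complex Metric Set Filter in
/-- A maximum principle on the part of a quadrant of a disc that lies off a closed set `S`:
a linear bound at the origin propagates from the boundary to the interior. -/
theorem norm_le_mul_norm_of_quadrant {G : ℂ → ℂ} (hG : Continuous G) {S : Set ℂ}
    (hS : IsClosed S) (hd : ∀ z ∉ S, DifferentiableAt ℂ G z) {ρ C : ℝ}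
    (hre : ∀ t : ℝ, 0 ≤ t → t ≤ ρ → ‖G t‖ ≤ C * t)
    (him : ∀ t : ℝ, 0 ≤ t → t ≤ ρ → ‖G (t * I)‖ ≤ C * t)
    (hbS : ∀ z ∈ S, ‖z‖ ≤ ρ → ‖G z‖ ≤ C * ‖z‖)
    (hbρ : ∀ z, ‖z‖ = ρ → ‖G z‖ ≤ C * ‖z‖)
    {z : ℂ} (hzre : 0 ≤ z.re) (hzim : 0 ≤ z.im) (hz : ‖z‖ ≤ ρ) : ‖G z‖ ≤ C * ‖z‖ := by
  have bdry : ∀ v : ℂ, 0 ≤ v.re → 0 ≤ v.im → ‖v‖ ≤ ρ →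
      (v.re = 0 ∨ v.im = 0 ∨ ‖v‖ = ρ ∨ v ∈ S) → ‖G v‖ ≤ C * ‖v‖ := by
    intro v h1 h2 h3 h4
    rcases h4 with h | h | h | h
    · have hv : v = (v.im : ℂ) * I := by apply Complex.ext <;> simp [h]
      have hn : ‖v‖ = v.im := by
        rw [hv, norm_mul, norm_I, mul_one, norm_real, Real.norm_eq_abs, abs_of_nonneg h2]
        simp
      rw [hn] at h3 ⊢
      rw [hv]
      simpa using him _ h2 h3
    · have hv : v = (v.re : ℂ) := by apply Complex.ext <;> simp [h]
      have hn : ‖v‖ = v.re := by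
        rw [hv, norm_real, Real.norm_eq_abs, abs_of_nonneg h1]
        simp
      rw [hn] at h3 ⊢
      rw [hv]
      simpa using hre _ h1 h3
    · exact hbρ v h
    · exact hbS v h h3
  by_cases hb : z.re = 0 ∨ z.im = 0 ∨ ‖z‖ = ρ ∨ z ∈ S
  · exact bdry z hzre hzim hz hb
  push Not at hb
  obtain ⟨hb1, hb2, hb3, hb4⟩ := hb
  set U : Set ℂ := {v | 0 < v.re} ∩ {v | 0 < v.im} ∩ {v | ‖v‖ < ρ} ∩ Sᶜ with hU
  have hUo : IsOpen U :=
    (((isOpen_lt continuous_const continuous_re).inter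
      (isOpen_lt continuous_const continuous_im)).inter
      (isOpen_lt continuous_norm continuous_const)).inter hS.isOpen_compl
  have hUc : closure U ⊆ {v | 0 ≤ v.re} ∩ {v | 0 ≤ v.im} ∩ {v | ‖v‖ ≤ ρ} := by
    refine closure_minimal ?_ (((isClosed_le continuous_const continuous_re).inter
      (isClosed_le continuous_const continuous_im)).inter
      (isClosed_le continuous_norm continuous_const))
    rintro v ⟨⟨⟨h1, h2⟩, h3⟩, -⟩
    exact ⟨⟨le_of_lt (show 0 < v.re from h1), le_of_lt (show 0 < v.im from h2)⟩,
      le_of_lt (show ‖v‖ < ρ from h3)⟩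
  have hUb : Bornology.IsBounded U :=
    isBounded_ball.subset (s := U) (t := ball (0 : ℂ) ρ) fun v hv => by
      simpa using hv.1.2
  have hzU : z ∈ U :=
    ⟨⟨⟨lt_of_le_of_ne hzre (Ne.symm hb1), lt_of_le_of_ne hzim (Ne.symm hb2)⟩,
      lt_of_le_of_ne hz hb3⟩, hb4⟩
  -- `G v / v` may be singular at the corner `0`. Moving the pole to `-η`, outside the quadrant,
  -- only enlarges the denominator, so the boundary bound `C` survives; then `η → 0`.
  have hlow : ∀ η : ℝ, 0 < η → ∀ v : ℂ, 0 ≤ v.re → 0 ≤ v.im → ‖v‖ ≤ ‖v + η‖ := by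
    intro η hη v h1 _
    rw [Complex.norm_def, Complex.norm_def]
    apply Real.sqrt_le_sqrt
    simp only [normSq_apply, add_re, ofReal_re, add_im, ofReal_im, add_zero]
    nlinarith
  have hne : ∀ η : ℝ, 0 < η → ∀ v ∈ closure U, v + η ≠ 0 := by
    intro η hη v hv h
    have h1 : 0 ≤ v.re := (hUc hv).1.1
    have := congrArg re h
    simp at this
    linarith
  have hC : 0 ≤ C := by
    have hzp : 0 < ρ := lt_of_le_of_lt (norm_nonneg z) (lt_of_le_of_ne hz hb3)
    have := (norm_nonneg _).trans (hre ρ hzp.le le_rfl)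
    exact nonneg_of_mul_nonneg_left this hzp
  have key : ∀ η : ℝ, 0 < η → ‖G z‖ ≤ C * ‖z + η‖ := by
    intro η hη
    have hdc : DiffContOnCl ℂ (fun v => G v / (v + η)) U := by
      refine ⟨fun v hv => ?_, ?_⟩
      · have h1 := hd v hv.2
        have h2 := hne η hη v (subset_closure hv)
        exact (h1.div (by fun_prop) h2).differentiableWithinAt
      · exact hG.continuousOn.div (by fun_prop) (hne η hη)
    have := norm_le_of_forall_mem_frontier_norm_le hUb hdc (C := C) ?_ (subset_closure hzU)
    · rw [norm_div, div_le_iff₀ (norm_pos_iff.2 (hne η hη z (subset_closure hzU)))] at this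
      exact this
    · intro v hv
      rw [hUo.frontier_eq] at hv
      have hvc := hUc hv.1
      obtain ⟨⟨h1, h2⟩, h3⟩ := hvc
      simp only [mem_ofPred_eq] at h1 h2 h3
      have hor : v.re = 0 ∨ v.im = 0 ∨ ‖v‖ = ρ ∨ v ∈ S := by
        by_contra hcon
        push Not at hcon
        exact hv.2 ⟨⟨⟨lt_of_le_of_ne h1 (Ne.symm hcon.1), lt_of_le_of_ne h2 (Ne.symm hcon.2.1)⟩,
          lt_of_le_of_ne h3 hcon.2.2.1⟩, hcon.2.2.2⟩
      rw [norm_div, div_le_iff₀ (norm_pos_iff.2 (hne η hη v hv.1))]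
      exact (bdry v h1 h2 h3 hor).trans
        (mul_le_mul_of_nonneg_left (hlow η hη v h1 h2) hC)
  have hlim : Tendsto (fun η : ℝ => C * ‖z + η‖) (𝓝[>] 0) (𝓝 (C * ‖z‖)) := by
    have : Continuous fun η : ℝ => C * ‖z + (η : ℂ)‖ := by fun_prop
    simpa using (this.tendsto 0).mono_left nhdsWithin_le_nhds
  exact ge_of_tendsto hlim (eventually_nhdsWithin_of_forall fun η hη => key η hη)

open Complex Metric Set Filter in
/-- If `F` is Lipschitz near `x` and has one-sided directional derivatives at `x` that depend
complex linearly on the direction, then `F` is complex differentiable at `x`. -/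
theorem LipschitzOnWith.differentiableAt_of_tendsto {F : ℂ → ℂ} {K : NNReal} {s : Set ℂ}
    (hF : LipschitzOnWith K F s) {x : ℂ} (hs : s ∈ 𝓝 x) {c : ℂ}
    (h : ∀ v : ℂ, Tendsto (fun ε : ℝ => ε⁻¹ • (F (x + ε • v) - F x)) (𝓝[>] 0) (𝓝 (c * v))) :
    DifferentiableAt ℂ F x := by
  obtain ⟨g, hg, hgF⟩ := hF.extend_finite_dimension
  have hev : F =ᶠ[𝓝 x] g := eventually_of_mem hs hgF
  have hx : F x = g x := hev.eq_of_nhds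
  have hright : ∀ v : ℂ,
      Tendsto (fun ε : ℝ => ε⁻¹ • (g (x + ε • v) - g x)) (𝓝[>] 0) (𝓝 (c * v)) := by
    intro v
    refine (h v).congr' ?_
    have hc : Tendsto (fun ε : ℝ => x + ε • v) (𝓝[>] 0) (𝓝 x) := by
      have : Continuous fun ε : ℝ => x + ε • v := by fun_prop
      simpa using (this.tendsto 0).mono_left nhdsWithin_le_nhds
    filter_upwards [hc.eventually hev] with ε hε
    rw [hε, hx]
  set L : ℂ →L[ℂ] ℂ := ContinuousLinearMap.toSpanSingleton ℂ c with hL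
  have hLv : ∀ v, L v = c * v := fun v => by simp [hL, mul_comm]
  have hline : ∀ v ∈ (univ : Set ℂ), HasLineDerivAt ℝ g (L.restrictScalars ℝ v) x v := by
    intro v _
    rw [hasLineDerivAt_iff_tendsto_slope_zero, ContinuousLinearMap.coe_restrictScalars', hLv,
      ← Iio_union_Ioi, nhdsWithin_union]
    refine Tendsto.sup ?_ (hright v)
    -- The left limit along `v` is the right limit along `-v`, by linearity in the direction.
    have h1 := (hright (-v)).neg
    have hneg : Tendsto (fun ε : ℝ => -ε) (𝓝[<] 0) (𝓝[>] 0) := by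
      simpa using tendsto_neg_nhdsLT (a := (0 : ℝ))
    have h2 := h1.comp hneg
    rw [mul_neg, neg_neg] at h2
    refine h2.congr fun ε => ?_
    simp [inv_neg]
  have hfd : HasFDerivAt g (L.restrictScalars ℝ) x :=
    hg.hasFDerivAt_of_hasLineDerivAt_of_closure (s := univ) (by simp) hline
  have := (hasFDerivAt_of_restrictScalars ℝ hfd rfl).differentiableAt
  exact this.congr_of_eventuallyEq hev

open Complex Metric Set Filter in
/-- A continuous function that is holomorphic off a closed set `S` and has linear bounds along the
four axis-parallel rays at the points of `S` has uniform linear bounds at the points of `S`. -/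
theorem exists_norm_sub_le_of_rays {F : ℂ → ℂ} (hF : Continuous F) {S : Set ℂ}
    (hS : IsClosed S) (hd : ∀ z ∉ S, DifferentiableAt ℂ F z) {x : ℂ} {r M : ℝ} (hr : 0 < r)
    (hM : 0 ≤ M)
    (hray : ∀ w ∈ S, ‖w - x‖ < r → ∀ u : ℂ, u ^ 4 = 1 → ∀ t : ℝ, 0 ≤ t → t ≤ r →
      ‖F (w + t * u) - F w‖ ≤ M * t) :
    ∃ C : ℝ, 0 ≤ C ∧ ∀ w ∈ S, ‖w - x‖ < r / 4 → ∀ z, ‖z - w‖ ≤ r / 4 →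
      ‖F z - F w‖ ≤ C * ‖z - w‖ := by
  obtain ⟨B, hB⟩ := (isCompact_closedBall x r).exists_bound_of_continuousOn hF.continuousOn
  have hB0 : 0 ≤ B := (norm_nonneg _).trans (hB x (mem_closedBall_self hr.le))
  have hI4 : I ^ 4 = 1 := I_pow_four
  have hre : ∀ w ∈ S, ‖w - x‖ < r → ∀ s : ℝ, |s| ≤ r → ‖F (w + s) - F w‖ ≤ M * |s| := by
    intro w hw hwx s hs
    rcases abs_cases s with ⟨h, -⟩ | ⟨h, -⟩
    · have := hray w hw hwx 1 (by norm_num) |s| (abs_nonneg s) hs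
      rw [h] at this ⊢
      simpa using this
    · have := hray w hw hwx (-1) (by norm_num) |s| (abs_nonneg s) hs
      rw [h] at this ⊢
      simpa using this
  have him : ∀ w ∈ S, ‖w - x‖ < r → ∀ s : ℝ, |s| ≤ r → ‖F (w + s * I) - F w‖ ≤ M * |s| := by
    intro w hw hwx s hs
    rcases abs_cases s with ⟨h, -⟩ | ⟨h, -⟩
    · have := hray w hw hwx I hI4 |s| (abs_nonneg s) hs
      rw [h] at this ⊢
      simpa using this
    · have := hray w hw hwx (-I) (by rw [Even.neg_pow (by decide), hI4]) |s| (abs_nonneg s) hs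
      rw [h] at this ⊢
      simpa using this
  -- Compare both values at the corner where the vertical line through `w` meets the horizontal line
  -- through `w'`.
  have hSS : ∀ w ∈ S, ‖w - x‖ < r → ∀ w' ∈ S, ‖w' - x‖ < r → ‖w' - w‖ ≤ r →
      ‖F w' - F w‖ ≤ 2 * M * ‖w' - w‖ := by
    intro w hw hwx w' hw' hwx' hww
    have h1 := abs_re_le_norm (w' - w)
    have h2 := abs_im_le_norm (w' - w)
    have e1 := him w hw hwx (w' - w).im (h2.trans hww)
    have e2 := hre w' hw' hwx' (-(w' - w).re) (by rw [abs_neg]; exact h1.trans hww)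
    have e3 : w' + ((-(w' - w).re : ℝ) : ℂ) = w + ((w' - w).im : ℝ) * I := by
      apply Complex.ext <;> simp
    rw [e3, abs_neg] at e2
    calc ‖F w' - F w‖ = ‖(F (w + ((w' - w).im : ℝ) * I) - F w)
          - (F (w + ((w' - w).im : ℝ) * I) - F w')‖ := by ring_nf
      _ ≤ _ := norm_sub_le _ _
      _ ≤ M * |(w' - w).im| + M * |(w' - w).re| := add_le_add e1 e2
      _ ≤ M * ‖w' - w‖ + M * ‖w' - w‖ := by gcongr
      _ = _ := by ring
  have hCm : 0 ≤ 8 * B / r := by positivity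
  -- `2 * M` serves the points of `S`; `8 * B / r` serves the arc of radius `r / 4`, where the
  -- difference is at most `2 * B`.
  set C := 2 * M + 8 * B / r with hC
  have hCM : M ≤ C := by linarith
  refine ⟨C, by linarith, fun w hw hwx z hz => ?_⟩
  -- Multiplication by `u` rotates the first quadrant onto any other and keeps rays axis-parallel.
  have quad : ∀ u : ℂ, u ^ 4 = 1 → ∀ v : ℂ, 0 ≤ v.re → 0 ≤ v.im → ‖v‖ ≤ r / 4 →
      ‖F (w + v * u) - F w‖ ≤ C * ‖v‖ := by
    intro u hu v hv1 hv2 hv3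
    have hun : ‖u‖ = 1 := norm_eq_one_of_pow_eq_one hu (by norm_num)
    refine norm_le_mul_norm_of_quadrant (G := fun v => F (w + v * u) - F w)
      (S := (fun v => w + v * u) ⁻¹' S) (ρ := r / 4) (by fun_prop)
      (hS.preimage (by fun_prop)) ?_ ?_ ?_ ?_ ?_ hv1 hv2 hv3
    · intro v hv
      have h1 : DifferentiableAt ℂ F (w + v * u) := hd _ hv
      exact (h1.comp v (f := fun v => w + v * u) (by fun_prop)).sub_const _
    · intro t h0 h1
      exact (hray w hw (by linarith) u hu t h0 (by linarith)).trans
        (mul_le_mul_of_nonneg_right hCM h0)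
    · intro t h0 h1
      have := hray w hw (by linarith) (I * u) (by rw [mul_pow, hI4, hu, one_mul]) t h0
        (by linarith)
      rw [← mul_assoc] at this
      exact this.trans (mul_le_mul_of_nonneg_right hCM h0)
    · intro v hv hvr
      have e : ‖w + v * u - w‖ = ‖v‖ := by simp [hun]
      have := hSS w hw (by linarith) (w + v * u) hv ?_ (by rw [e]; linarith)
      · rw [e] at this
        exact this.trans (by gcongr; linarith)
      · calc ‖w + v * u - x‖ = ‖(w + v * u - w) + (w - x)‖ := by ring_nf
          _ ≤ _ := norm_add_le _ _
          _ < r := by rw [e]; linarith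
    · intro v hv
      have e : ‖w + v * u - w‖ = ‖v‖ := by simp [hun]
      have m1 : ‖F (w + v * u)‖ ≤ B := hB _ <| by
        rw [mem_closedBall, dist_eq]
        calc ‖w + v * u - x‖ = ‖(w + v * u - w) + (w - x)‖ := by ring_nf
          _ ≤ _ := norm_add_le _ _
          _ ≤ r := by rw [e]; linarith
      have m2 : ‖F w‖ ≤ B := hB _ <| by
        rw [mem_closedBall, dist_eq]; linarith
      calc ‖F (w + v * u) - F w‖ ≤ _ := norm_sub_le _ _
        _ ≤ B + B := add_le_add m1 m2
        _ = 8 * B / r * (r / 4) := by field_simp; ring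
        _ ≤ C * ‖v‖ := by rw [hv]; gcongr; linarith
  set v := z - w with hv
  have hzv : z = w + v := by simp [hv]
  have hI : I * I = -1 := I_mul_I
  rcases le_total 0 v.re with h1 | h1 <;> rcases le_total 0 v.im with h2 | h2
  · have := quad 1 (by norm_num) v h1 h2 hz
    rwa [mul_one, ← hzv] at this
  · have := quad (-I) (by rw [Even.neg_pow (by decide), hI4]) (I * v) (by simpa) (by simpa)
      (by simpa using hz)
    rw [show w + I * v * -I = w + v by linear_combination (-v) * hI, ← hzv] at this
    simpa using this
  · have := quad I hI4 (-I * v) (by simpa) (by simpa) (by simpa using hz)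
    rw [show w + -I * v * I = w + v by linear_combination (-v) * hI, ← hzv] at this
    simpa using this
  · have := quad (-1) (by norm_num) (-v) (by simpa) (by simpa) (by simpa using hz)
    rw [show w + -v * -1 = w + v by ring, ← hzv] at this
    simpa using this

open Complex Metric Set Filter in
/-- A function that is holomorphic off a closed set `S` and has uniform linear bounds at the points
of `S` near `x ∈ S` is Lipschitz near `x`. -/
theorem lipschitzOnWith_of_norm_sub_le {F : ℂ → ℂ} {S : Set ℂ}
    (hS : IsClosed S) (hd : ∀ z ∉ S, DifferentiableAt ℂ F z) (hF : Continuous F)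
    {x : ℂ} (hx : x ∈ S) {r C : ℝ} (hC : 0 ≤ C)
    (h : ∀ w ∈ S, ‖w - x‖ < r → ∀ z, ‖z - w‖ ≤ r → ‖F z - F w‖ ≤ C * ‖z - w‖) :
    LipschitzOnWith (2 * C).toNNReal F (ball x (r / 4)) := by
  have hder : ∀ z ∈ ball x (r / 4), z ∉ S → ‖deriv F z‖ ≤ 2 * C := by
    intro z hz hzS
    -- Cauchy's estimate on the largest disc about `z` missing `S`: its points lie within `2 * d` of
    -- the nearest point `w` of `S`.
    obtain ⟨w, hw, hdist⟩ := hS.exists_infDist_eq_dist ⟨x, hx⟩ z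
    set d := infDist z S with hdd
    have hdpos : 0 < d := (hS.notMem_iff_infDist_pos ⟨x, hx⟩).1 hzS
    have hdx : d ≤ dist z x := infDist_le_dist_of_mem hx
    rw [mem_ball] at hz
    have hwx : ‖w - x‖ < r := by
      rw [← dist_eq]
      have := dist_triangle w z x
      rw [dist_comm w z] at this
      linarith [dist_nonneg (x := z) (y := x)]
    have hdc : DiffContOnCl ℂ (fun v => F v - F w) (ball z d) := by
      refine ⟨fun v hv => ?_, by fun_prop⟩
      have : v ∉ S := fun hvS => by
        have h1 : d ≤ dist z v := infDist_le_dist_of_mem hvS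
        rw [mem_ball, dist_comm] at hv
        linarith
      exact ((hd v this).sub_const _).differentiableWithinAt
    have := norm_deriv_le_of_forall_mem_sphere_norm_le (C := 2 * C * d) hdpos hdc ?_
    · rwa [deriv_sub_const_fun, mul_div_cancel_right₀ _ hdpos.ne'] at this
    · intro v hv
      rw [mem_sphere] at hv
      have h2 : ‖v - w‖ ≤ 2 * d := by
        rw [← dist_eq]
        linarith [dist_triangle v z w]
      calc ‖F v - F w‖ ≤ C * ‖v - w‖ :=
            h w hw hwx v (by linarith [dist_nonneg (x := z) (y := x)])
        _ ≤ C * (2 * d) := by gcongr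
        _ = _ := by ring
  refine LipschitzOnWith.of_dist_le_mul fun a ha b hb => ?_
  rw [Real.coe_toNNReal _ (by linarith)]
  -- A segment meeting `S` is split at a common point; otherwise the derivative bound holds along
  -- all of it.
  by_cases hseg : ∃ w ∈ segment ℝ a b, w ∈ S
  · obtain ⟨w, hwab, hw⟩ := hseg
    have hwb : w ∈ ball x (r / 4) := (convex_ball x (r / 4)).segment_subset ha hb hwab
    have hadd := dist_add_dist_of_mem_segment hwab
    rw [mem_ball] at ha hb hwb
    have hr0 : 0 < r / 4 := dist_nonneg.trans_lt ha
    have hwx : ‖w - x‖ < r := by rw [← dist_eq]; linarith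
    have key : ∀ c, dist c x < r / 4 → dist (F c) (F w) ≤ C * dist c w := by
      intro c hc
      rw [dist_eq, dist_eq]
      refine h w hw hwx c ?_
      rw [← dist_eq]
      linarith [dist_triangle_right c w x]
    calc dist (F a) (F b) ≤ dist (F a) (F w) + dist (F b) (F w) := dist_triangle_right _ _ _
      _ ≤ C * dist a w + C * dist b w := add_le_add (key a ha) (key b hb)
      _ = C * dist a b := by rw [← hadd, dist_comm b w]; ring
      _ ≤ 2 * C * dist a b := by nlinarith [dist_nonneg (x := a) (y := b)]
  · push Not at hseg
    rw [dist_comm (F a), dist_comm a, dist_eq, dist_eq]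
    exact (convex_segment a b).norm_image_sub_le_of_norm_deriv_le (fun c hc => hd c (hseg c hc))
      (fun c hc => hder c ((convex_ball x (r / 4)).segment_subset ha hb hc) (hseg c hc))
      (left_mem_segment ℝ a b) (right_mem_segment ℝ a b)

open Complex Metric Set Filter in
/-- A continuous function on the plane that has, at every point of an open set `D`, one-sided
directional derivatives depending complex linearly on the direction, is analytic on `D`. -/
theorem Continuous.analyticOnNhd_of_tendsto {F : ℂ → ℂ} (hF : Continuous F) {D : Set ℂ}
    (hD : IsOpen D)
    (h : ∀ w ∈ D, ∃ c : ℂ, ∀ v : ℂ,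
      Tendsto (fun ε : ℝ => ε⁻¹ • (F (w + ε • v) - F w)) (𝓝[>] 0) (𝓝 (c * v))) :
    AnalyticOnNhd ℂ F D := by
  by_contra hcon
  set S : Set ℂ := {z | AnalyticAt ℂ F z}ᶜ with hSdef
  have hS : IsClosed S := (isOpen_analyticAt ℂ F).isClosed_compl
  have hd : ∀ z ∉ S, DifferentiableAt ℂ F z := fun z hz =>
    (not_not.1 hz : AnalyticAt ℂ F z).differentiableAt
  have hne : (D ∩ S).Nonempty := by
    simp only [AnalyticOnNhd] at hcon
    push Not at hcon
    obtain ⟨z, hz, hz'⟩ := hcon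
    exact ⟨z, hz, hz'⟩
  have : Nonempty ↥(D ∩ S) := hne.to_subtype
  have : LocallyCompactSpace ↥(D ∩ S) :=
    (hD.isLocallyClosed.inter hS.isLocallyClosed).locallyCompactSpace
  -- Baire sets: `n` governs both the slope and the length of the four rays. Only finitely many
  -- directions are used, so each point lies in some `W n`.
  set W : ℕ → Set ↥(D ∩ S) := fun n => {w | ∀ u : ℂ, u ^ 4 = 1 → ∀ t : ℝ, 0 ≤ t →
    t ≤ 1 / (n + 1) → ‖F (w + t * u) - F w‖ ≤ n * t} with hW
  have hWc : ∀ n, IsClosed (W n) := by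
    intro n
    simp only [hW, ofPred_forall]
    refine isClosed_iInter fun u => isClosed_iInter fun _ => isClosed_iInter fun t =>
      isClosed_iInter fun _ => isClosed_iInter fun _ => isClosed_le ?_ continuous_const
    fun_prop
  have hWu : ⋃ n, W n = univ := by
    refine eq_univ_of_forall fun w => ?_
    obtain ⟨c, hc⟩ := h w w.2.1
    have hfin : {u : ℂ | u ^ 4 = 1}.Finite := by
      have := (Polynomial.nthRootsFinset 4 (1 : ℂ)).finite_toSet
      refine this.subset fun u hu => ?_
      exact (Polynomial.mem_nthRootsFinset (by norm_num) _).2 hu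
    have hev : ∀ᶠ ε : ℝ in 𝓝[>] 0, ∀ u ∈ {u : ℂ | u ^ 4 = 1},
        ‖ε⁻¹ • (F (w + ε • u) - F w)‖ < ‖c‖ + 1 := by
      rw [hfin.eventually_all]
      intro u hu
      have hun : ‖u‖ = 1 := norm_eq_one_of_pow_eq_one hu (by norm_num)
      refine (hc u).norm.eventually_lt_const ?_
      rw [norm_mul, hun]
      linarith
    obtain ⟨δ, hδ, hδ'⟩ := mem_nhdsGT_iff_exists_Ioo_subset.1 hev
    obtain ⟨n₁, hn₁⟩ := exists_nat_one_div_lt (show (0 : ℝ) < δ from hδ)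
    obtain ⟨n₂, hn₂⟩ := exists_nat_ge (‖c‖ + 1)
    refine mem_iUnion.2 ⟨max n₁ n₂, fun u hu t ht0 ht => ?_⟩
    rcases ht0.eq_or_lt with rfl | htpos
    · simp
    have htδ : t < δ := by
      refine (ht.trans ?_).trans_lt hn₁
      gcongr
      exact le_max_left _ _
    have := hδ' ⟨htpos, htδ⟩ u hu
    rw [norm_smul, norm_inv, Real.norm_eq_abs, abs_of_pos htpos, real_smul,
      inv_mul_lt_iff₀ htpos] at this
    refine this.le.trans ?_
    rw [mul_comm]
    gcongr
    exact hn₂.trans (by exact_mod_cast le_max_right _ _)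
  obtain ⟨n, ⟨x, hx⟩⟩ := nonempty_interior_of_iUnion_of_closed hWc hWu
  rw [mem_interior_iff_mem_nhds, Metric.mem_nhds_iff] at hx
  obtain ⟨r₁, hr₁, hxW⟩ := hx
  obtain ⟨r₂, hr₂, hxD⟩ := Metric.isOpen_iff.1 hD x x.2.1
  have hnpos : (0 : ℝ) < 1 / (n + 1) := Nat.one_div_pos_of_nat
  set r := min (min r₁ r₂) (1 / ((n : ℝ) + 1)) with hr
  have hr0 : 0 < r := lt_min (lt_min hr₁ hr₂) hnpos
  have hle₁ : r ≤ r₁ := (min_le_left _ _).trans (min_le_left _ _)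
  have hle₂ : r ≤ r₂ := (min_le_left _ _).trans (min_le_right _ _)
  have hray : ∀ w ∈ S, ‖w - x‖ < r → ∀ u : ℂ, u ^ 4 = 1 → ∀ t : ℝ, 0 ≤ t → t ≤ r →
      ‖F (w + t * u) - F w‖ ≤ n * t := by
    intro w hw hwx u hu t ht0 htr
    have hwD : w ∈ D := hxD (by rw [mem_ball, dist_eq]; linarith)
    have hwW : (⟨w, hwD, hw⟩ : ↥(D ∩ S)) ∈ W n := hxW (by
      rw [mem_ball, Subtype.dist_eq, dist_eq]
      exact hwx.trans_le hle₁)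
    exact hwW u hu t ht0 (htr.trans (min_le_right _ _))
  obtain ⟨C, hC, hCb⟩ := exists_norm_sub_le_of_rays hF hS hd hr0 (Nat.cast_nonneg n) hray
  have hlip := lipschitzOnWith_of_norm_sub_le hS hd hF x.2.2 hC hCb
  refine x.2.2 (DifferentiableOn.analyticAt (s := ball (x : ℂ) (r / 4 / 4)) (fun z hz => ?_)
    (ball_mem_nhds _ (by positivity)))
  obtain ⟨c, hc⟩ := h z (hxD (ball_subset_ball (by linarith) hz))
  exact (hlip.differentiableAt_of_tendsto (isOpen_ball.mem_nhds hz) hc).differentiableWithinAt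

open Complex Metric Set Filter in
/-- A continuous function on an open set `D` that has, at every point of `D`, one-sided
directional derivatives depending complex linearly on the direction, is analytic on `D`. -/
theorem ContinuousOn.analyticOnNhd_of_tendsto {F : ℂ → ℂ} {D : Set ℂ} (hF : ContinuousOn F D)
    (hD : IsOpen D)
    (h : ∀ w ∈ D, ∃ c : ℂ, ∀ v : ℂ,
      Tendsto (fun ε : ℝ => ε⁻¹ • (F (w + ε • v) - F w)) (𝓝[>] 0) (𝓝 (c * v))) :
    AnalyticOnNhd ℂ F D := by
  intro x hx
  obtain ⟨r, hr, hxr⟩ := Metric.nhds_basis_closedBall.mem_iff.1 (hD.mem_nhds hx)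
  -- Tietze extension reduces to a function continuous on the whole plane.
  obtain ⟨G, hG⟩ := ContinuousMap.exists_restrict_eq (s := closedBall x r) isClosed_closedBall
    ⟨_, (hF.mono hxr).domRestrict⟩
  have hGF : ∀ z ∈ closedBall x r, G z = F z := fun z hz => DFunLike.congr_fun hG ⟨z, hz⟩
  have hev : ∀ z ∈ ball x r, G =ᶠ[𝓝 z] F := fun z hz =>
    eventually_of_mem (isOpen_ball.mem_nhds hz) fun w hw => hGF w (ball_subset_closedBall hw)
  have hGa : AnalyticOnNhd ℂ G (ball x r) := by
    refine G.continuous.analyticOnNhd_of_tendsto isOpen_ball fun w hw => ?_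
    obtain ⟨c, hc⟩ := h w (hxr (ball_subset_closedBall hw))
    refine ⟨c, fun v => (hc v).congr' ?_⟩
    have hlim : Tendsto (fun ε : ℝ => w + ε • v) (𝓝[>] 0) (𝓝 w) := by
      have : Continuous fun ε : ℝ => w + ε • v := by fun_prop
      simpa using (this.tendsto 0).mono_left nhdsWithin_le_nhds
    filter_upwards [hlim.eventually (hev w hw)] with ε hε
    rw [hε, (hev w hw).eq_of_nhds]
  exact (hGa x (mem_ball_self hr)).congr (hev x (mem_ball_self hr))

/-! ### Descent along the fibres of a linear form -/

open Complex Metric Set Filter in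
/-- Let `Ω` be open and convex in the direction of the kernel of `l : V → ℂ`. A continuous function
on `Ω` whose one-sided directional derivatives at every point are a complex multiple of `l` is an
analytic function of `l`. -/
theorem exists_analyticOnNhd_comp_of_tendsto {V : Type*} [NormedAddCommGroup V] [NormedSpace ℝ V]
    [FiniteDimensional ℝ V] (l : V →ₗ[ℝ] ℂ) (hl : Function.Surjective l) {Ω : Set V}
    (hΩ : IsOpen Ω) (hconv : ∀ p ∈ Ω, ∀ q ∈ Ω, l p = l q → segment ℝ p q ⊆ Ω) {U : V → ℂ}
    (hU : ContinuousOn U Ω)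
    (h : ∀ p ∈ Ω, ∃ c : ℂ, ∀ v : V,
      Tendsto (fun ε : ℝ => ε⁻¹ • (U (p + ε • v) - U p)) (𝓝[>] 0) (𝓝 (c * l v))) :
    ∃ F : ℂ → ℂ, AnalyticOnNhd ℂ F (l '' Ω) ∧ ∀ p ∈ Ω, U p = F (l p) := by
  have hconst : ∀ p ∈ Ω, ∀ q ∈ Ω, l p = l q → U q = U p := by
    intro p hp q hq hpq
    have hseg : ∀ t ∈ Icc (0 : ℝ) 1, p + t • (q - p) ∈ Ω := fun t ht =>
      hconv p hp q hq hpq (by rw [segment_eq_image']; exact ⟨t, ht, rfl⟩)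
    have hker : l (q - p) = 0 := by rw [map_sub, hpq, sub_self]
    -- A vanishing right derivative suffices for a continuous function to be constant.
    have := constant_of_has_deriv_right_zero (f := fun t : ℝ => U (p + t • (q - p)))
      (a := 0) (b := 1) (hU.comp (by fun_prop) hseg) ?_ 1 (by simp)
    · simpa using this
    · intro t ht
      obtain ⟨c, hc⟩ := h _ (hseg t ⟨ht.1, ht.2.le⟩)
      have h1 := hc (q - p)
      rw [hker, mul_zero] at h1
      rw [← hasDerivWithinAt_Ioi_iff_Ici, hasDerivWithinAt_iff_tendsto_slope' (by simp)]
      have hsub : Tendsto (fun s : ℝ => s - t) (𝓝[>] t) (𝓝[>] 0) := by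
        refine tendsto_nhdsWithin_iff.2 ⟨?_, ?_⟩
        · have : Continuous fun s : ℝ => s - t := by fun_prop
          simpa using (this.tendsto t).mono_left nhdsWithin_le_nhds
        · exact eventually_nhdsWithin_of_forall fun s hs => by simpa using hs
      refine (h1.comp hsub).congr fun s => ?_
      simp only [Function.comp, slope_def_module]
      rw [add_assoc, ← add_smul, add_sub_cancel]
  obtain ⟨σ, hσ⟩ := l.exists_rightInverse_of_surjective (LinearMap.range_eq_top.2 hl)
  have hσl : ∀ w, l (σ w) = w := fun w => LinearMap.congr_fun hσ w
  have hσc : Continuous σ := σ.continuous_of_finiteDimensional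
  set F : ℂ → ℂ := fun w => U (Function.invFunOn l Ω w) with hF
  have hUF : ∀ p ∈ Ω, U p = F (l p) := by
    intro p hp
    have hex : ∃ q ∈ Ω, l q = l p := ⟨p, hp, rfl⟩
    exact hconst _ (Function.invFunOn_mem hex) p hp (Function.invFunOn_eq hex)
  have hD : IsOpen (l '' Ω) := by
    have := l.toContinuousLinearMap.isOpenMap hl
    exact this Ω hΩ
  -- `F` chooses preimages arbitrarily, but locally it agrees with `U` on an affine section through
  -- `p`, which supplies continuity and directional derivatives.
  have hsec : ∀ p ∈ Ω, (fun w => U (p + σ (w - l p))) =ᶠ[𝓝 (l p)] F := by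
    intro p hp
    have hc : Continuous fun w => p + σ (w - l p) := by fun_prop
    have hn : ∀ᶠ w in 𝓝 (l p), p + σ (w - l p) ∈ Ω :=
      hc.continuousAt.eventually_mem (hΩ.mem_nhds (by simpa using hp))
    filter_upwards [hn] with w hw
    rw [hUF _ hw, map_add, hσl, add_sub_cancel]
  refine ⟨F, ContinuousOn.analyticOnNhd_of_tendsto ?_ hD ?_, hUF⟩
  · rintro _ ⟨p, hp, rfl⟩
    refine ContinuousAt.continuousWithinAt (ContinuousAt.congr ?_ (hsec p hp))
    have hc : Continuous fun w => p + σ (w - l p) := by fun_prop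
    refine ContinuousAt.comp (f := fun w => p + σ (w - l p)) (g := U) ?_ hc.continuousAt
    simpa using hU.continuousAt (hΩ.mem_nhds hp)
  · rintro _ ⟨p, hp, rfl⟩
    obtain ⟨c, hc⟩ := h p hp
    refine ⟨c, fun v => ?_⟩
    have h1 := hc (σ v)
    rw [hσl] at h1
    refine h1.congr' ?_
    have hlim : Tendsto (fun ε : ℝ => l p + ε • v) (𝓝[>] 0) (𝓝 (l p)) := by
      have : Continuous fun ε : ℝ => l p + ε • v := by fun_prop
      simpa using (this.tendsto 0).mono_left nhdsWithin_le_nhds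
    filter_upwards [hlim.eventually (hsec p hp)] with ε hε
    rw [← hε, ← hUF p hp, add_sub_cancel_left, map_smul]

/-! ### Coordinates of complex quaternions -/

namespace CQuat

theorem continuous_coords : Continuous coords :=
  (AddMonoidHomClass.isometry_of_norm coords fun _ => rfl).continuous

/-- Right multiplication by `u e₁ + v e₂` in the coordinates of the basis `e₁, e₂, e₃, e₄`. -/
theorem coords_mul (q : ℍ[ℂ]) (u v : ℂ) :
    coords (q * (u • e₁ + v • e₂)) =
      !₂[coords q 0 * u, coords q 1 * v, coords q 2 * v, coords q 3 * u] := by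
  have hI := Complex.I_mul_I
  ext k; fin_cases k <;> simp [coords] <;> simp [e₁, e₂] <;> grind

theorem e₁_add_e₂ : e₁ + e₂ = 1 := by
  ext <;> simp <;> simp [e₁, e₂] <;> ring

/-- The real linear map `p ↦ p₀ + p₁ a + p₂ b`. -/
def linearForm (a b : ℂ) : EuclideanSpace ℝ (Fin 3) →ₗ[ℝ] ℂ where
  toFun p := p 0 + p 1 * a + p 2 * b
  map_add' p q := by simp; ring
  map_smul' c q := by simp; ring

theorem linearForm_apply (a b : ℂ) (p : EuclideanSpace ℝ (Fin 3)) :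
    linearForm a b p = p 0 + p 1 * a + p 2 * b := rfl

theorem mem_line_iff (a b : ℂ) (p : EuclideanSpace ℝ (Fin 3)) :
    p ∈ line a b ↔ linearForm a b p = 0 := by
  simp [line, linearForm_apply, Complex.ext_iff]

theorem zeta_add_smul (i₁ i₂ i₃ : ℍ[ℂ]) (p v : EuclideanSpace ℝ (Fin 3)) (ε : ℝ) :
    zeta i₁ i₂ i₃ (p + ε • v) = zeta i₁ i₂ i₃ p + ε • zeta i₁ i₂ i₃ v := by
  simp only [zeta, PiLp.add_apply, PiLp.smul_apply, smul_eq_mul]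
  module

theorem mem_E₃_iff (i₁ i₂ i₃ ζ : ℍ[ℂ]) :
    ζ ∈ E₃ i₁ i₂ i₃ ↔ ∃ p, zeta i₁ i₂ i₃ p = ζ := by
  rw [E₃, Submodule.mem_span_triple]
  constructor
  · rintro ⟨a, b, c, rfl⟩
    exact ⟨!₂[a, b, c], by simp [zeta]⟩
  · rintro ⟨p, rfl⟩
    exact ⟨p 0, p 1, p 2, rfl⟩

/-- Holds because `1 = e₁ + e₂`; it puts `ζ` in the form that `coords_mul` needs. -/
theorem zeta_eq (a₁ a₂ b₁ b₂ : ℂ) (p : EuclideanSpace ℝ (Fin 3)) :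
    zeta 1 (a₁ • e₁ + a₂ • e₂) (b₁ • e₁ + b₂ • e₂) p =
      linearForm a₁ b₁ p • e₁ + linearForm a₂ b₂ p • e₂ := by
  have h : ∀ (r : ℝ) (q : ℍ[ℂ]), r • q = (r : ℂ) • q := fun r q =>
    (algebraMap_smul ℂ r q).symm
  simp only [zeta, linearForm_apply, h, ← e₁_add_e₂]
  module

theorem coords_real_smul (r : ℝ) (q : ℍ[ℂ]) (k : Fin 4) :
    coords (r • q) k = r • coords q k := by
  rw [coords.map_smul_of_tower]
  rfl

theorem continuous_zeta (i₁ i₂ i₃ : ℍ[ℂ]) : Continuous (zeta i₁ i₂ i₃) := by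
  refine (AddMonoidHomClass.isometry_of_norm coords fun _ => rfl).isEmbedding.continuous_iff.2 ?_
  have h : coords ∘ zeta i₁ i₂ i₃ =
      fun p => p 0 • coords i₁ + p 1 • coords i₂ + p 2 • coords i₃ := by
    ext p k
    simp [zeta]
  rw [h]
  fun_prop

open Filter in
/-- Every coordinate of a left-`G`-monogenic map, on which right multiplication by the elements of
`E₃` acts through a linear form `l`, is an analytic function of `l`. -/
theorem LeftGMonogenic.exists_analyticOnNhd {i₁ i₂ i₃ : ℍ[ℂ]} {Ω : Set (EuclideanSpace ℝ (Fin 3))}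
    {Φ : ℍ[ℂ] → ℍ[ℂ]} (hΦ : LeftGMonogenic (E₃ i₁ i₂ i₃) (zeta i₁ i₂ i₃ '' Ω) Φ) (hΩ : IsOpen Ω)
    {a b : ℂ} (hl : Function.Surjective (linearForm a b))
    (hconv : ConvexInDirection Ω (line a b)) (k : Fin 4)
    (hk : ∀ q p, coords (q * zeta i₁ i₂ i₃ p) k = coords q k * linearForm a b p) :
    ∃ F : ℂ → ℂ, AnalyticOnNhd ℂ F (linearForm a b '' Ω) ∧
      ∀ p ∈ Ω, coords (Φ (zeta i₁ i₂ i₃ p)) k = F (linearForm a b p) := by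
  have hck : Continuous fun q : ℍ[ℂ] => coords q k :=
    (EuclideanSpace.proj k).continuous.comp continuous_coords
  refine exists_analyticOnNhd_comp_of_tendsto (linearForm a b) hl hΩ (fun p hp q hq hpq => ?_)
    (U := fun p => coords (Φ (zeta i₁ i₂ i₃ p)) k) ?_ fun p hp => ?_
  · refine hconv p hp q hq ((mem_line_iff a b _).2 ?_)
    rw [map_sub, hpq, sub_self]
  · exact hck.comp_continuousOn (hΦ.1.comp (continuous_zeta i₁ i₂ i₃).continuousOn
      (Set.mapsTo_image _ _))
  · obtain ⟨Φ', hΦ'⟩ := hΦ.2 _ (Set.mem_image_of_mem _ hp)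
    refine ⟨coords Φ' k, fun v => ?_⟩
    have h := (hck.tendsto _).comp (hΦ' (zeta i₁ i₂ i₃ v) ((mem_E₃_iff _ _ _ _).2 ⟨v, rfl⟩))
    rw [hk] at h
    refine h.congr fun ε => ?_
    simp only [Function.comp, coords_real_smul, map_sub, PiLp.sub_apply, zeta_add_smul]

end CQuat

/-! ### The representation theorem -/

theorem mainTheorem2 (a₁ a₂ b₁ b₂ : ℂ) (i₁ i₂ i₃ : ℍ[ℂ])
    (hi₁ : i₁ = 1)
    (hi₂ : i₂ = a₁ • CQuat.e₁ + a₂ • CQuat.e₂)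
    (hi₃ : i₃ = b₁ • CQuat.e₁ + b₂ • CQuat.e₂)
    (hli : LinearIndependent ℝ ![i₁, i₂, i₃])
    (hf₁ : CQuat.f₁ '' (CQuat.E₃ i₁ i₂ i₃ : Set ℍ[ℂ]) = Set.univ)
    (hf₂ : CQuat.f₂ '' (CQuat.E₃ i₁ i₂ i₃ : Set ℍ[ℂ]) = Set.univ)
    (Ω : Set (EuclideanSpace ℝ (Fin 3))) (hΩo : IsOpen Ω) (hΩc : IsConnected Ω)
    (hL₁ : CQuat.ConvexInDirection Ω (CQuat.line a₁ b₁))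
    (hL₂ : CQuat.ConvexInDirection Ω (CQuat.line a₂ b₂))
    (Φ : ℍ[ℂ] → ℍ[ℂ])
    (hΦ : CQuat.LeftGMonogenic (CQuat.E₃ i₁ i₂ i₃) (CQuat.zeta i₁ i₂ i₃ '' Ω) Φ) :
    ∃ F₁ F₂ F₃ F₄ : ℂ → ℂ,
      AnalyticOnNhd ℂ F₁ (CQuat.f₁ '' (CQuat.zeta i₁ i₂ i₃ '' Ω)) ∧
      AnalyticOnNhd ℂ F₂ (CQuat.f₂ '' (CQuat.zeta i₁ i₂ i₃ '' Ω)) ∧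
      AnalyticOnNhd ℂ F₃ (CQuat.f₂ '' (CQuat.zeta i₁ i₂ i₃ '' Ω)) ∧
      AnalyticOnNhd ℂ F₄ (CQuat.f₁ '' (CQuat.zeta i₁ i₂ i₃ '' Ω)) ∧
      ∀ ζ ∈ CQuat.zeta i₁ i₂ i₃ '' Ω,
        Φ ζ = F₁ (CQuat.f₁ ζ) • CQuat.e₁ + F₂ (CQuat.f₂ ζ) • CQuat.e₂ +
          F₃ (CQuat.f₂ ζ) • CQuat.e₃ + F₄ (CQuat.f₁ ζ) • CQuat.e₄ := by
  subst hi₁ hi₂ hi₃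
  have hf1 : ∀ p, CQuat.f₁ (CQuat.zeta 1 (a₁ • CQuat.e₁ + a₂ • CQuat.e₂)
      (b₁ • CQuat.e₁ + b₂ • CQuat.e₂) p) = CQuat.linearForm a₁ b₁ p :=
    CQuat.f₁_zeta a₁ a₂ b₁ b₂
  have hf2 : ∀ p, CQuat.f₂ (CQuat.zeta 1 (a₁ • CQuat.e₁ + a₂ • CQuat.e₂)
      (b₁ • CQuat.e₁ + b₂ • CQuat.e₂) p) = CQuat.linearForm a₂ b₂ p :=
    CQuat.f₂_zeta a₁ a₂ b₁ b₂
  have hs1 : Function.Surjective (CQuat.linearForm a₁ b₁) := fun w => by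
    obtain ⟨ζ, hζ, rfl⟩ := hf₁.ge (Set.mem_univ w)
    obtain ⟨p, rfl⟩ := (CQuat.mem_E₃_iff _ _ _ _).1 hζ
    exact ⟨p, (hf1 p).symm⟩
  have hs2 : Function.Surjective (CQuat.linearForm a₂ b₂) := fun w => by
    obtain ⟨ζ, hζ, rfl⟩ := hf₂.ge (Set.mem_univ w)
    obtain ⟨p, rfl⟩ := (CQuat.mem_E₃_iff _ _ _ _).1 hζ
    exact ⟨p, (hf2 p).symm⟩
  -- By `coords_mul`, coordinates `0` and `3` are scaled by `ξ₁`, coordinates `1` and `2` by `ξ₂`.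
  obtain ⟨F₁, hF₁, hF₁'⟩ := hΦ.exists_analyticOnNhd hΩo hs1 hL₁ 0 fun q p => by
    rw [CQuat.zeta_eq, CQuat.coords_mul]; rfl
  obtain ⟨F₂, hF₂, hF₂'⟩ := hΦ.exists_analyticOnNhd hΩo hs2 hL₂ 1 fun q p => by
    rw [CQuat.zeta_eq, CQuat.coords_mul]; rfl
  obtain ⟨F₃, hF₃, hF₃'⟩ := hΦ.exists_analyticOnNhd hΩo hs2 hL₂ 2 fun q p => by
    rw [CQuat.zeta_eq, CQuat.coords_mul]; rfl
  obtain ⟨F₄, hF₄, hF₄'⟩ := hΦ.exists_analyticOnNhd hΩo hs1 hL₁ 3 fun q p => by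
    rw [CQuat.zeta_eq, CQuat.coords_mul]; rfl
  simp only [Set.image_image, hf1, hf2]
  refine ⟨F₁, F₂, F₃, F₄, hF₁, hF₂, hF₃, hF₄, ?_⟩
  rintro _ ⟨p, hp, rfl⟩
  rw [hf1, hf2, ← hF₁' p hp, ← hF₂' p hp, ← hF₃' p hp, ← hF₄' p hp]
  exact CQuat.eq_sum_coords _
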